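/- **Theorem (linear complexity, case $q=p$).** Let $p$ be a prime, let $F/\mathbb{F}_q$ be an algebraic function field in one variable with $q=p$, let $\sigma\in\mathrm{Aut}(F/\mathbb{F}_q)$, let $P$ be a rational place of $F$ (a place of degree $1$), and let $n$ be the smallest positive integer with $\sigma^n(P)=P$. Put $P_i=\sigma^i(P)$ for $i\ge 0$. For a place $R$ write $v_R$ for its normalized discrete valuation, $m_R(f)$ for the order of the pole of $f\in F$ at $R$ (with $m_R(f)=0$ if $v_R(f)\ge 0$), and $$m_R^*(f)=\min\{\,m_R(f-(h-h^p)) : h\in F\,\}.$$ Let $z\in F$ be such that $v_{P_i}(z)\ge 0$ for all $i$. Suppose that $z$ has a unique pole $Q$, that $\gcd(v_Q(z),p)=1$, and that the places $Q,\sigma(Q),\ldots,\sigma^{n-1}(Q)$ are pairwise distinct. Let $\mathbf{s}_z$ be the sequence over $\mathbb{F}_p$ with terms $s_i=\mathrm{Tr}(z(P_i))$, where $\mathrm{Tr}$ is the trace from $\mathbb{F}_q$ to $\mathbb{F}_p$. Then $$\mathrm{L}(\mathbf{s}_z)\ \ge\ \frac{n-m_Q^*(z)\,d}{m_Q^*(z)\,d+1},\qquad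 d=\deg Q,$$ and the same bound also holds with $d=\deg (z)_\infty$, the degree of the pole divisor of $z$. Here $\mathrm{L}(\mathbf{s}_z)$ is the linear complexity, that is, the least $L\ge 0$ for which there are $\lambda_0,\ldots,\lambda_L\in\mathbb{F}_p$ with $\lambda_0=1$, $\lambda_L\ne 0$ and $\lambda_0s_{i+L}+\lambda_1s_{i+L-1}+\cdots+\lambda_Ls_i=0$ for all admissible $i$. The bound holds both for the finite sequence $(s_0,\ldots,s_{n-1})$ (admissible: $0\le i\le n-1-L$) and for the periodic sequence $(s_i)_{i\ge 0}$ (admissible: all $i\ge 0$). -/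

import Mathlib

/-- `F / K` is an algebraic function field of one variable: `F` is a finite extension of `K(x)`
for some `x` in `F` that is transcendental over `K`. -/
def IsAlgebraicFunctionField (K F : Type*) [Field K] [Field F] [Algebra K F] : Prop :=
  ∃ x : F, Transcendental K x ∧ FiniteDimensional (IntermediateField.adjoin K {x}) F

/-- A place of `F / K`, given by its valuation ring `O`: a valuation ring of `F` that contains
`K` and is different from `F`. The place itself is the maximal ideal of `O`. -/
@[ext]
structure FFPlace (K F : Type*) [Field K] [Field F] [Algebra K F] where
  ring : ValuationSubring F
  algebraMap_mem : ∀ a : K, algebraMap K F a ∈ ring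
  ne_top : ring ≠ ⊤

namespace FFPlace

variable {K F : Type*} [Field K] [Field F] [Algebra K F]

noncomputable instance instAlgebraRing (P : FFPlace K F) : Algebra K P.ring :=
  ((algebraMap K F).codRestrict P.ring.toSubring P.algebraMap_mem).toAlgebra

/-- The residue class field `F_P`. -/
abbrev residueField (P : FFPlace K F) : Type _ := IsLocalRing.ResidueField P.ring

/-- `deg P = [F_P : K]`. -/
noncomputable def degree (P : FFPlace K F) : ℕ := Module.finrank K P.residueField

/-- The largest `k` such that `f` lies in the `k`-th power of the maximal ideal of `O_P`. -/
noncomputable def ordNat (P : FFPlace K F) (f : P.ring) : ℕ :=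
  sSup {k : ℕ | f ∈ IsLocalRing.maximalIdeal P.ring ^ k}

open Classical in
/-- The normalized discrete valuation `v_P`. Being integer-valued, it takes the value `0`
instead of `∞` at the zero function; it is only used for the condition `0 ≤ v_P(f)` and for
the order of a pole, which are not affected by this convention. -/
noncomputable def v (P : FFPlace K F) (f : F) : ℤ :=
  if f = 0 then 0
  else if h : f ∈ P.ring then (P.ordNat ⟨f, h⟩ : ℤ)
  else -(P.ordNat ⟨f⁻¹, (P.ring.mem_or_inv_mem f).resolve_left h⟩ : ℤ)

/-- `P` is a pole of `f`. -/
def IsPole (P : FFPlace K F) (f : F) : Prop := P.v f < 0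

/-- `m_P(f)`: the order of the pole of `f` at `P`, and `0` if `f` is regular at `P`. -/
noncomputable def poleOrder (P : FFPlace K F) (f : F) : ℕ := (-P.v f).toNat

/-- The reduced pole order
`m_P^*(f) = min {m_P(f - g) | g = h - h ^ p for some h in F}`. -/
noncomputable def reducedPoleOrder (p : ℕ) (P : FFPlace K F) (f : F) : ℕ :=
  sInf {m : ℕ | ∃ h : F, m = P.poleOrder (f - (h - h ^ p))}

/-- The degree of the pole divisor `(f)_∞ = ∑_P m_P(f) P`. -/
noncomputable def poleDivisorDegree (K : Type*) {F : Type*} [Field K] [Field F] [Algebra K F]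
    (f : F) : ℕ :=
  ∑ᶠ P : FFPlace K F, P.poleOrder f * P.degree

/-- The action of `Aut(F/K)` on places: `O_{σ(P)} = σ(O_P)`. -/
def map (σ : F ≃ₐ[K] F) (P : FFPlace K F) : FFPlace K F where
  ring := P.ring.comap (σ.symm : F →+* F)
  algebraMap_mem a := by
    rw [ValuationSubring.mem_comap]
    simpa using P.algebraMap_mem a
  ne_top h := by
    refine P.ne_top (eq_top_iff.2 fun x _ => ?_)
    have hx : σ x ∈ P.ring.comap (σ.symm : F →+* F) := h ▸ ValuationSubring.mem_top _
    rw [ValuationSubring.mem_comap] at hx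
    simpa using hx

/-- The value `f(P)` in `K` of a function `f` regular at a rational place `P`: the element `a`
of `K` with the same residue class as `f`, that is, such that `f - a` lies in the maximal ideal
of `O_P`. -/
noncomputable def value (P : FFPlace K F) (f : F) : K :=
  Classical.epsilon fun a : K => f - algebraMap K F a ∈ P.ring.nonunits

end FFPlace

/-- The sequence `s_z`, with `s_i = Tr (z(P_i))`, where `P_i = σ^i(P)` and `Tr` is the trace
from `K` to `F_p`. -/
noncomputable def traceSequence (p : ℕ) [Fact p.Prime] {K F : Type*} [Field K]
    [Algebra (ZMod p) K] [Field F] [Algebra K F] (σ : F ≃ₐ[K] F) (P : FFPlace K F) (z : F)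
    (i : ℕ) : ZMod p :=
  Algebra.trace (ZMod p) K ((P.map (σ ^ i)).value z)

/-- The linear complexity of an infinite periodic sequence `s_0, s_1, …`: the least `L` for
which there are `c_0 = 1, c_1, …, c_L ≠ 0` with
`c_0 s_{i+L} + c_1 s_{i+L-1} + ⋯ + c_L s_i = 0` for all `i ≥ 0`. -/
noncomputable def linearComplexity {k : Type*} [Field k] (s : ℕ → k) : ℕ :=
  sInf {L : ℕ | ∃ c : ℕ → k, c 0 = 1 ∧ c L ≠ 0 ∧
    ∀ i : ℕ, ∑ j ∈ Finset.range (L + 1), c j * s (i + (L - j)) = 0}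

/-- The linear complexity of the finite sequence `s_0, …, s_{N-1}`: as above, the recurrence
being required whenever all terms `s_i, …, s_{i+L}` belong to the finite sequence. -/
noncomputable def finiteLinearComplexity {k : Type*} [Field k] (N : ℕ) (s : ℕ → k) : ℕ :=
  sInf {L : ℕ | ∃ c : ℕ → k, c 0 = 1 ∧ c L ≠ 0 ∧
    ∀ i : ℕ, i + L < N → ∑ j ∈ Finset.range (L + 1), c j * s (i + (L - j)) = 0}

/-!
The bound follows from counting the zeros and poles of one function. Suppose that the terms
`s_0, …, s_{n-1}` satisfy a recurrence of length `L < n` with coefficients `c_0 = 1, …, c_L`. As `K`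
is the prime field, the trace is the identity, so `s_{i+k} = z(P_{i+k})` is the value at `P_i` of
`σ^{-k} z`. Hence `w = ∑ c_j σ^{-(L-j)} z` vanishes at the `n - L` distinct rational places
`P_0, …, P_{n-1-L}`. Its poles are among `σ^{-k} Q` with `k ≤ L`, each of order at most
`m = m_Q(z)`, and it does have a pole at `σ^{-L} Q`, since `c_0 = 1` and these places are
distinct. A nonconstant function has no more rational zeros than the degree of its pole divisor, so
`n - L ≤ (L + 1) m deg Q` (`FFPlace.sub_le_of_recurrence`). This is the asserted bound because
`m_Q^*(z) = m` when `m` is prime to `p` (`FFPlace.reducedPoleOrder_eq_poleOrder`), because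
`deg (z)_∞ = m deg Q ≥ deg Q`, and because a recurrence for the periodic sequence is one for the
finite sequence.

The inequality between zeros and poles, `FFPlace.card_rational_zeros_le`, is proved without
divisors or the fundamental equality `∑ e f = [F : K(w)]`. Functions `t_i` that are dual to the
zeros `R_j` make the products `w ^ j t_i` linearly independent over `K`, and the span of those with
`1 ≤ j ≤ l` is compared, as `l` tends to infinity, with the finite space of principal parts along
the poles of `w`. The functions `t_i` come from a feature of finite fields: `1 / (y ^ q - y + 1)`
takes the value `1` at each rational place where `y` is regular, and the value `0` at each
rational pole of `y` (`FFPlace.exists_dual_family`).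

That the valuation ring of a place is a discrete valuation ring with finite residue degree is
derived from `FFPlace.finite_quotient_span`: for `w ≠ 0` in the maximal ideal, `O_P / w O_P` has
dimension at most `[F : K(w)]` over `K`. The linear algebra behind this and behind the count of
zeros and poles is `eq_zero_of_sum_aeval_mul_eq_zero`.
-/

section

open Polynomial IntermediateField

/-! ### Function fields over the polynomials in one element -/

theorem Algebra.isAlgebraic_adjoin_of_transcendental {K F : Type*} [Field K] [Field F]
    [Algebra K F] (hF : IsAlgebraicFunctionField K F) {w : F} (hw : Transcendental K w) :
    Algebra.IsAlgebraic (Algebra.adjoin K {w}) F := by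
  obtain ⟨x, -, hfin⟩ := hF
  have h1 : Algebra.IsAlgebraic (Algebra.adjoin K {x}) F :=
    (IntermediateField.isAlgebraic_adjoin_iff_top (F := K) (s := {x}) (S := F)).1 inferInstance
  have h2 : Algebra.trdeg K F ≤ 1 := by
    simpa using Algebra.IsAlgebraic.trdeg_le_cardinalMk K ({x} : Set F)
  have h3 : AlgebraicIndependent K (fun _ : Unit => w) :=
    (algebraicIndependent_unique_type_iff (ι := Unit)).2 hw
  have h4 : IsTranscendenceBasis K (fun _ : Unit => w) :=
    h3.isTranscendenceBasis_of_lift_trdeg_le_of_finite (by simpa using h2)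
  have h5 := h4.isAlgebraic
  rwa [Set.range_const] at h5

theorem IsAlgebraicFunctionField.finiteDimensional_adjoin {K F : Type*} [Field K] [Field F]
    [Algebra K F] (hF : IsAlgebraicFunctionField K F) {w : F} (hw : Transcendental K w) :
    FiniteDimensional K⟮w⟯ F := by
  have halg := Algebra.isAlgebraic_adjoin_of_transcendental hF hw
  have : Algebra.IsAlgebraic K⟮w⟯ F :=
    (IntermediateField.isAlgebraic_adjoin_iff_top (F := K) (s := {w}) (S := F)).2 halg
  obtain ⟨x, -, hfin⟩ := hF
  have hx : Algebra.EssFiniteType K K⟮x⟯ :=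
    IntermediateField.essFiniteType_iff.2 ⟨{x}, by simp⟩
  have : Algebra.EssFiniteType K F := .comp K K⟮x⟯ F
  have : Algebra.EssFiniteType K⟮w⟯ F := .of_comp K _ _
  exact Algebra.finite_of_essFiniteType_of_isAlgebraic

/-- Elements of a `K`-algebra `B` whose images in `B / w B` are linearly independent over `K` are
linearly independent over the polynomials in `w`. -/
theorem eq_zero_of_sum_aeval_mul_eq_zero {K F ι : Type*} [Field K] [Field F] [Algebra K F]
    [Fintype ι] (B : Subalgebra K F) {w : F} (hw : w ∈ B) (hw0 : w ≠ 0) {t : ι → F}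
    (ht : ∀ i, t i ∈ B)
    (H : ∀ c : ι → K, ∀ b ∈ B, ∑ i, c i • t i = w * b → c = 0) (q : ι → K[X])
    (hq : ∑ i, aeval w (q i) * t i = 0) : q = 0 := by
  -- modulo `w` only the constant terms of the `q i` remain; once they vanish, divide by `w`
  suffices h : ∀ (D : ℕ) (q : ι → K[X]), (∀ i, ∀ k ≥ D, (q i).coeff k = 0) →
      ∑ i, aeval w (q i) * t i = 0 → q = 0 by
    refine h (Finset.univ.sup fun i => (q i).natDegree + 1) q (fun i k hk => ?_) hq
    refine coeff_eq_zero_of_natDegree_lt (lt_of_lt_of_le (Nat.lt_succ_self _) (le_trans ?_ hk))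
    exact Finset.le_sup (f := fun i => (q i).natDegree + 1) (Finset.mem_univ i)
  intro D
  induction D with
  | zero =>
    intro q hD _
    ext i k
    simpa using hD i k (Nat.zero_le _)
  | succ D ih =>
    intro q hD hq
    have hsplit : ∀ i, aeval w (q i) = w * aeval w (q i).divX + algebraMap K F ((q i).coeff 0) := by
      intro i
      conv_lhs => rw [← X_mul_divX_add (q i)]
      rw [map_add, map_mul, aeval_X, aeval_C]
    have hdiv : ∑ i, (q i).coeff 0 • t i = w * -∑ i, aeval w (q i).divX * t i := by
      rw [mul_neg, eq_neg_iff_add_eq_zero, ← hq, Finset.mul_sum, ← Finset.sum_add_distrib]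
      refine Finset.sum_congr rfl fun i _ => ?_
      rw [hsplit i, Algebra.smul_def]
      ring
    have haeval : ∀ p : K[X], aeval w p ∈ B := fun p => by
      have := Subalgebra.aeval_coe B ⟨w, hw⟩ p
      simp only at this
      rw [this]
      exact SetLike.coe_mem _
    have hc := H _ _ (B.neg_mem (B.sum_mem fun i _ => B.mul_mem (haeval _) (ht i))) hdiv
    have h0 : ∀ i, (q i).coeff 0 = 0 := fun i => congrFun hc i
    have hsum : ∑ i, aeval w (q i).divX * t i = 0 := by
      simp only [h0, zero_smul, Finset.sum_const_zero] at hdiv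
      simpa [hw0] using hdiv.symm
    have := ih (fun i => (q i).divX) (fun i k hk => by
      rw [coeff_divX]; exact hD i _ (by omega)) hsum
    ext i k
    cases k with
    | zero => simpa using h0 i
    | succ k =>
      rw [← coeff_divX, show (q i).divX = 0 from congrFun this i]
      simp

/-! ### The valuation ring of a place -/

namespace FFPlace

variable {K F : Type*} [Field K] [Field F] [Algebra K F]

instance instIsScalarTowerRing (P : FFPlace K F) : IsScalarTower K P.ring F :=
  .of_algebraMap_eq fun _ => rfl

/-- The valuation ring of a place, as a `K`-subalgebra of `F`. -/
def toSubalgebra (P : FFPlace K F) : Subalgebra K F where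
  __ := P.ring.toSubring
  algebraMap_mem' := P.algebraMap_mem

@[simp]
theorem mem_toSubalgebra (P : FFPlace K F) {f : F} : f ∈ P.toSubalgebra ↔ f ∈ P.ring := Iff.rfl

theorem mem_ring_of_isIntegralElem (P : FFPlace K F) {A : Type*} [CommRing A] (g : A →+* F)
    (hg : ∀ a, g a ∈ P.ring) {f : F} (hf : g.IsIntegralElem f) : f ∈ P.ring := by
  obtain ⟨q, hq, hqf⟩ := hf
  have hint : IsIntegral P.ring f := by
    refine ⟨q.map (g.codRestrict P.ring.toSubring hg), hq.map _, ?_⟩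
    rw [eval₂_map]
    exact hqf
  obtain ⟨y, rfl⟩ := IsIntegrallyClosed.isIntegral_iff.1 hint
  exact y.2

theorem mem_ring_of_isAlgebraic (P : FFPlace K F) {f : F} (hf : IsAlgebraic K f) : f ∈ P.ring :=
  P.mem_ring_of_isIntegralElem (algebraMap K F) P.algebraMap_mem hf.isIntegral

theorem eq_zero_of_isAlgebraic (P : FFPlace K F) {f : F} (hf : IsAlgebraic K f)
    (hfP : f ∈ P.ring.nonunits) : f = 0 :=
  ((P.ring.mem_nonunits_iff_or).1 hfP).resolve_right
    fun h => h (P.mem_ring_of_isAlgebraic hf.inv)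

theorem transcendental_of_mem_nonunits (P : FFPlace K F) {f : F} (hfP : f ∈ P.ring.nonunits)
    (hf0 : f ≠ 0) : Transcendental K f := fun h => hf0 (P.eq_zero_of_isAlgebraic h hfP)

/-- Lifts to `O_P` of elements of `O_P / w O_P` that are independent over `K` are independent
over `K(w)`, and `F` has finite degree over `K(w)`. -/
theorem finite_quotient_span (hF : IsAlgebraicFunctionField K F) (P : FFPlace K F) {w : P.ring}
    (hw : w ∈ IsLocalRing.maximalIdeal P.ring) (hw0 : w ≠ 0) :
    Module.Finite K (P.ring ⧸ Ideal.span {w}) := by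
  have hw0' : (w : F) ≠ 0 := by simpa using hw0
  have htr : Transcendental K (w : F) :=
    P.transcendental_of_mem_nonunits (ValuationSubring.coe_mem_nonunits_iff.2 hw) hw0'
  have hfin := hF.finiteDimensional_adjoin htr
  refine Module.rank_lt_aleph0_iff.1 (lt_of_le_of_lt
    (rank_le (n := Module.finrank K⟮(w : F)⟯ F) fun s hs => ?_) Cardinal.natCast_lt_aleph0)
  choose t ht using fun x : P.ring ⧸ Ideal.span {w} => Ideal.Quotient.mk_surjective x
  have hli : LinearIndependent (Algebra.adjoin K {(w : F)})
      fun i : s => ((t i.1 : P.ring) : F) := by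
    rw [Fintype.linearIndependent_iff]
    intro g hg
    have hex : ∀ i, ∃ q : K[X], aeval (w : F) q = g i := fun i => by
      have h : ∀ y ∈ Algebra.adjoin K {(w : F)}, ∃ q : K[X], aeval (w : F) q = y := fun y hy => by
        rwa [Algebra.adjoin_singleton_eq_range_aeval] at hy
      exact h _ (g i).2
    choose q hq using hex
    have hq0 := eq_zero_of_sum_aeval_mul_eq_zero P.toSubalgebra w.2 hw0'
      (t := fun i : s => ((t i.1 : P.ring) : F)) (fun i => (t i.1).2)
      (fun c b (hb : b ∈ P.ring) hcb => ?_) q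
      (by simpa [hq, Algebra.smul_def] using hg)
    · intro i
      apply Subtype.ext
      rw [← hq i, hq0]
      simp
    · rw [Fintype.linearIndependent_iff] at hs
      refine funext (hs c ?_)
      have hcb' : ∑ i : s, c i • t i.1 = w * ⟨b, hb⟩ := by
        apply Subtype.ext
        rw [MulMemClass.coe_mul, ← hcb, AddSubmonoidClass.coe_finsetSum]
        refine Finset.sum_congr rfl fun i _ => ?_
        rw [Algebra.smul_def, Algebra.smul_def]
        rfl
      have := congrArg (Ideal.Quotient.mk (Ideal.span {w})) hcb'
      rw [map_sum, map_mul, Ideal.Quotient.eq_zero_iff_mem.2 (Ideal.mem_span_singleton_self w),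
        zero_mul] at this
      rw [← this]
      refine Finset.sum_congr rfl fun i _ => ?_
      conv_lhs => rw [← ht i.1]
      rfl
  have hli' : LinearIndependent K⟮(w : F)⟯ fun i : s => ((t i.1 : P.ring) : F) := by
    open scoped IntermediateField.algebraAdjoinAdjoin in
    exact (LinearIndependent.iff_fractionRing (Algebra.adjoin K {(w : F)}) K⟮(w : F)⟯).1 hli
  simpa using hli'.fintype_card_le_finrank

theorem maximalIdeal_ne_bot (P : FFPlace K F) : IsLocalRing.maximalIdeal P.ring ≠ ⊥ := by
  intro h
  refine P.ne_top (eq_top_iff.2 fun x _ => ?_)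
  by_contra hx
  have hx0 : x ≠ 0 := fun h => hx (h ▸ P.ring.zero_mem)
  have h1 : x⁻¹ ∈ P.ring.nonunits := by
    rw [ValuationSubring.mem_nonunits_iff_or, inv_inv]
    exact .inr hx
  obtain ⟨ha, hm⟩ := ValuationSubring.mem_nonunits_iff_exists_mem_maximalIdeal.1 h1
  rw [h, Ideal.mem_bot] at hm
  exact inv_ne_zero hx0 (congrArg Subtype.val hm)

theorem isNoetherianRing (hF : IsAlgebraicFunctionField K F) (P : FFPlace K F) :
    IsNoetherianRing P.ring := by
  refine ⟨fun I => ?_⟩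
  rcases eq_or_ne I ⊥ with rfl | hI
  · exact Submodule.fg_bot
  rcases eq_or_ne I ⊤ with rfl | hI'
  · exact Submodule.FG.of_finite
  obtain ⟨w, hwI, hw0⟩ := Submodule.exists_mem_ne_zero_of_ne_bot hI
  have := P.finite_quotient_span hF (IsLocalRing.le_maximalIdeal hI' hwI) hw0
  refine Submodule.fg_of_fg_map_of_fg_inf_ker (Ideal.span {w}).mkQ ?_ ?_
  · exact Submodule.FG.of_restrictScalars K (IsNoetherian.noetherian
      ((Submodule.map (Ideal.span {w}).mkQ I).restrictScalars K))
  · rw [Submodule.ker_mkQ, inf_eq_right.2 ((Ideal.span_singleton_le_iff_mem _).2 hwI)]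
    exact ⟨{w}, by simp⟩

theorem isDiscreteValuationRing (hF : IsAlgebraicFunctionField K F) (P : FFPlace K F) :
    IsDiscreteValuationRing P.ring := by
  have := P.isNoetherianRing hF
  have : IsPrincipalIdealRing P.ring := inferInstance
  exact { not_a_field' := P.maximalIdeal_ne_bot }

theorem finite_residueField (hF : IsAlgebraicFunctionField K F) (P : FFPlace K F) :
    Module.Finite K P.residueField := by
  obtain ⟨w, hwI, hw0⟩ := Submodule.exists_mem_ne_zero_of_ne_bot P.maximalIdeal_ne_bot
  have := P.finite_quotient_span hF hwI hw0
  have hle : Ideal.span {w} ≤ IsLocalRing.maximalIdeal P.ring :=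
    (Ideal.span_singleton_le_iff_mem _).2 hwI
  exact Module.Finite.of_surjective (Ideal.Quotient.factorₐ K hle).toLinearMap
    (Ideal.Quotient.factor_surjective hle)

/-! ### The valuation and the pole order -/

theorem ordNat_unit_mul_pow (P : FFPlace K F) [IsDiscreteValuationRing P.ring] {ϖ : P.ring}
    (hϖ : Irreducible ϖ) (u : P.ringˣ) (k : ℕ) : P.ordNat (u * ϖ ^ k) = k := by
  have h : {j : ℕ | (u * ϖ ^ k : P.ring) ∈ IsLocalRing.maximalIdeal P.ring ^ j} = Set.Iic k := by
    ext j
    rw [Set.mem_ofPred_eq, hϖ.maximalIdeal_eq, Ideal.span_singleton_pow,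
      Ideal.mem_span_singleton, (Units.isUnit u).dvd_mul_left,
      pow_dvd_pow_iff hϖ.ne_zero hϖ.not_isUnit, Set.mem_Iic]
  rw [ordNat, h]
  exact csSup_Iic

theorem valuation_eq_zpow_v (P : FFPlace K F) [IsDiscreteValuationRing P.ring] {ϖ : P.ring}
    (hϖ : Irreducible ϖ) {f : F} (hf : f ≠ 0) :
    P.ring.valuation f = P.ring.valuation (ϖ : F) ^ P.v f := by
  have key : ∀ g : P.ring, g ≠ 0 →
      P.ring.valuation (g : F) = P.ring.valuation (ϖ : F) ^ P.ordNat g := by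
    intro g hg
    obtain ⟨k, u, rfl⟩ := IsDiscreteValuationRing.eq_unit_mul_pow_irreducible hg hϖ
    rw [P.ordNat_unit_mul_pow hϖ, MulMemClass.coe_mul, map_mul, P.ring.valuation_unit, one_mul,
      SubmonoidClass.coe_pow, map_pow]
  rw [v, if_neg hf]
  split_ifs with h
  · rw [zpow_natCast, ← key _ (fun h0 => hf (congrArg Subtype.val h0))]
  · have hinv := (P.ring.mem_or_inv_mem f).resolve_left h
    have := key ⟨f⁻¹, hinv⟩ (fun h0 => inv_ne_zero hf (congrArg Subtype.val h0))
    rw [zpow_neg, zpow_natCast, ← this, map_inv₀, inv_inv]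

section

variable (P : FFPlace K F) {ϖ : P.ring}

theorem valuation_pos_of_irreducible (hϖ : Irreducible ϖ) : 0 < P.ring.valuation (ϖ : F) :=
  zero_lt_iff.2 ((Valuation.ne_zero_iff _).2 fun h => hϖ.ne_zero (Subtype.ext h))

theorem valuation_lt_one_of_irreducible (hϖ : Irreducible ϖ) : P.ring.valuation (ϖ : F) < 1 :=
  (P.ring.valuation_lt_one_iff ϖ).1 ((IsLocalRing.mem_maximalIdeal _).2 hϖ.not_isUnit)

variable [IsDiscreteValuationRing P.ring]

/-- The pole order of `f` is the least `a` for which `ϖ ^ a * f` is regular. -/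
theorem pow_mul_mem_iff (hϖ : Irreducible ϖ) (f : F) (a : ℕ) :
    (ϖ : F) ^ a * f ∈ P.ring ↔ P.poleOrder f ≤ a := by
  rcases eq_or_ne f 0 with rfl | hf
  · simp [poleOrder, v]
  have h0 := P.valuation_pos_of_irreducible hϖ
  rw [← P.ring.valuation_le_one_iff, map_mul, map_pow, P.valuation_eq_zpow_v hϖ hf,
    ← zpow_natCast, ← zpow_add₀ h0.ne', ← zpow_zero (P.ring.valuation (ϖ : F)),
    zpow_le_zpow_iff_right_of_lt_one₀ h0 (P.valuation_lt_one_of_irreducible hϖ), poleOrder]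
  omega

theorem poleOrder_eq_zero_iff (f : F) : P.poleOrder f = 0 ↔ f ∈ P.ring := by
  obtain ⟨ϖ, hϖ⟩ := IsDiscreteValuationRing.exists_irreducible P.ring
  rw [← Nat.le_zero, ← P.pow_mul_mem_iff hϖ, pow_zero, one_mul]

theorem isPole_iff_notMem (f : F) : P.IsPole f ↔ f ∉ P.ring := by
  rw [← poleOrder_eq_zero_iff, IsPole, poleOrder]
  omega

theorem v_nonneg_iff_mem (f : F) : 0 ≤ P.v f ↔ f ∈ P.ring := by
  rw [← not_lt, ← IsPole, isPole_iff_notMem, not_not]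

theorem poleOrder_le_of_valuation_le {f g : F} (h : P.ring.valuation f ≤ P.ring.valuation g) :
    P.poleOrder f ≤ P.poleOrder g := by
  obtain ⟨ϖ, hϖ⟩ := IsDiscreteValuationRing.exists_irreducible P.ring
  have := (P.pow_mul_mem_iff hϖ g _).2 le_rfl
  rw [← P.pow_mul_mem_iff hϖ f]
  rw [← P.ring.valuation_le_one_iff, map_mul] at this ⊢
  exact (mul_le_mul_right h _).trans this

/-- A discrete valuation ring is a maximal proper subring of its field of fractions. -/
theorem eq_of_ring_le (R : FFPlace K F) (h : P.ring ≤ R.ring) : P = R := by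
  obtain ⟨ϖ, hϖ⟩ := IsDiscreteValuationRing.exists_irreducible P.ring
  refine FFPlace.ext (le_antisymm h fun y hyR => ?_)
  by_contra hyP
  refine R.ne_top (eq_top_iff.2 fun f _ => ?_)
  have hy0 : y ≠ 0 := fun h => hyP (h ▸ P.ring.zero_mem)
  -- `ϖ⁻¹` has the least valuation above `1`, so a power of `y` dominates any given `f`
  have hval : 1 ≤ P.ring.valuation ((ϖ : F) * y) := by
    by_contra hlt
    have h1 : 1 ≤ P.poleOrder y := Nat.one_le_iff_ne_zero.2 ((P.poleOrder_eq_zero_iff y).not.2 hyP)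
    have h2 := P.isPole_iff_notMem y |>.2 hyP
    rw [IsPole] at h2
    have h0 := P.valuation_pos_of_irreducible hϖ
    rw [map_mul, P.valuation_eq_zpow_v hϖ hy0, ← zpow_one_add₀ h0.ne', not_le,
      ← zpow_zero (P.ring.valuation (ϖ : F)),
      zpow_lt_zpow_iff_right_of_lt_one₀ h0 (P.valuation_lt_one_of_irreducible hϖ)] at hlt
    omega
  set N := P.poleOrder f
  have hN : (y⁻¹) ^ N * f ∈ P.ring := by
    have h1 := (P.pow_mul_mem_iff hϖ f N).2 le_rfl
    rw [← P.ring.valuation_le_one_iff] at h1 ⊢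
    have h2 : (ϖ : F) ^ N * f = ((ϖ : F) * y) ^ N * (y⁻¹ ^ N * f) := by
      rw [mul_pow, inv_pow]
      field_simp
    rw [h2, map_mul, map_pow] at h1
    exact (le_mul_of_one_le_left' (one_le_pow₀ hval)).trans h1
  have : f = y ^ N * (y⁻¹ ^ N * f) := by
    rw [inv_pow]
    field_simp
  rw [this]
  exact R.ring.mul_mem _ _ (pow_mem hyR N) (h hN)

/-- Subtracting `h - h ^ p` cannot lower a pole order prime to `p`: a pole of `h` gives
`h - h ^ p` a pole of order divisible by `p`, so the two poles do not cancel. -/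
theorem reducedPoleOrder_eq_poleOrder {p : ℕ} (hp : 1 < p) {z : F} (hz : P.IsPole z)
    (hgcd : Int.gcd (P.v z) p = 1) : P.reducedPoleOrder p z = P.poleOrder z := by
  obtain ⟨ϖ, hϖ⟩ := IsDiscreteValuationRing.exists_irreducible P.ring
  have h0 := P.valuation_pos_of_irreducible hϖ
  have h1 := P.valuation_lt_one_of_irreducible hϖ
  have hz0 : z ≠ 0 := by
    rintro rfl
    simp [IsPole, v] at hz
  refine le_antisymm (Nat.sInf_le ⟨0, by simp [show p ≠ 0 by omega]⟩) ?_
  refine le_csInf ⟨_, 0, rfl⟩ ?_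
  rintro _ ⟨h, rfl⟩
  refine P.poleOrder_le_of_valuation_le ?_
  have hzval : 1 < P.ring.valuation z := by
    rw [← not_le, P.ring.valuation_le_one_iff]
    exact (P.isPole_iff_notMem z).1 hz
  have hle : P.ring.valuation (h - h ^ p) < P.ring.valuation z ∨
      P.ring.valuation z < P.ring.valuation (h - h ^ p) := by
    by_cases hh : h ∈ P.ring
    · left
      exact ((P.ring.valuation_le_one_iff _).2 (sub_mem hh (pow_mem hh p))).trans_lt hzval
    · have hh1 : 1 < P.ring.valuation h := by
        rwa [← not_le, P.ring.valuation_le_one_iff]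
      have hh0 : h ≠ 0 := fun h => hh (h ▸ P.ring.zero_mem)
      have hlt : P.ring.valuation h < P.ring.valuation (h ^ p) := by
        rw [map_pow]
        exact lt_self_pow₀ hh1 hp
      rw [Valuation.map_sub_eq_of_lt_right _ hlt, map_pow]
      refine lt_or_gt_of_ne fun heq => ?_
      rw [P.valuation_eq_zpow_v hϖ hh0, P.valuation_eq_zpow_v hϖ hz0, ← zpow_natCast,
        ← zpow_mul] at heq
      have := zpow_right_injective₀ h0 h1.ne heq
      rw [← this] at hgcd
      simp at hgcd
      omega
  rcases hle with hlt | hlt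
  · rw [Valuation.map_sub_eq_of_lt_left _ hlt]
  · rw [Valuation.map_sub_eq_of_lt_right _ hlt]
    exact hlt.le

end

theorem mul_mem_nonunits (P : FFPlace K F) {x y : F} (hx : x ∈ P.ring) (hy : y ∈ P.ring.nonunits) :
    x * y ∈ P.ring.nonunits := by
  rw [ValuationSubring.mem_nonunits_iff, map_mul] at *
  exact mul_lt_one_of_nonneg_of_lt_one_right ((P.ring.valuation_le_one_iff x).2 hx) zero_le hy

/-! ### The action of automorphisms on places -/

theorem mem_map (σ : F ≃ₐ[K] F) (P : FFPlace K F) {f : F} :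
    f ∈ (P.map σ).ring ↔ σ.symm f ∈ P.ring := Iff.rfl

theorem mem_nonunits_map (σ : F ≃ₐ[K] F) (P : FFPlace K F) {f : F} :
    f ∈ (P.map σ).ring.nonunits ↔ σ.symm f ∈ P.ring.nonunits := by
  rw [ValuationSubring.mem_nonunits_iff_or, ValuationSubring.mem_nonunits_iff_or, mem_map]
  simp

theorem map_map (σ τ : F ≃ₐ[K] F) (P : FFPlace K F) : (P.map σ).map τ = P.map (τ * σ) := rfl

theorem map_one (P : FFPlace K F) : P.map 1 = P := rfl

theorem map_injective (σ : F ≃ₐ[K] F) : Function.Injective (map σ : FFPlace K F → _) :=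
  fun P R h => by
    rw [← P.map_one, ← R.map_one, ← inv_mul_cancel σ, ← map_map, ← map_map]
    exact congrArg (map σ⁻¹) h

/-- The isomorphism of valuation rings induced by an automorphism. -/
def mapRingEquiv (σ : F ≃ₐ[K] F) (P : FFPlace K F) : P.ring ≃+* (P.map σ).ring where
  toFun f := ⟨σ f, by rw [mem_map]; simp⟩
  invFun f := ⟨σ.symm f, f.2⟩
  left_inv f := by simp
  right_inv f := by simp
  map_mul' f g := by ext; simp
  map_add' f g := by ext; simp

theorem degree_map (σ : F ≃ₐ[K] F) (P : FFPlace K F) : (P.map σ).degree = P.degree := by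
  let e := IsLocalRing.ResidueField.mapEquiv (mapRingEquiv σ P)
  refine (LinearEquiv.finrank_eq (R := K) (M := P.residueField) (N := (P.map σ).residueField)
    { e with map_smul' := fun a x => ?_ }).symm
  obtain ⟨x, rfl⟩ := IsLocalRing.residue_surjective x
  have h : mapRingEquiv σ P (algebraMap K P.ring a) = algebraMap K (P.map σ).ring a :=
    Subtype.ext (σ.commutes a)
  rw [Algebra.smul_def, Algebra.smul_def]
  change e (IsLocalRing.residue P.ring (algebraMap K P.ring a) * _) =
    IsLocalRing.residue (P.map σ).ring (algebraMap K (P.map σ).ring a) * e _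
  rw [map_mul, ← h]
  rfl

theorem poleOrder_map (hF : IsAlgebraicFunctionField K F) (σ : F ≃ₐ[K] F) (P : FFPlace K F)
    (f : F) : (P.map σ).poleOrder f = P.poleOrder (σ.symm f) := by
  have := P.isDiscreteValuationRing hF
  have := (P.map σ).isDiscreteValuationRing hF
  obtain ⟨ϖ, hϖ⟩ := IsDiscreteValuationRing.exists_irreducible P.ring
  have hϖ' : Irreducible (mapRingEquiv σ P ϖ) := (MulEquiv.irreducible_iff _).2 hϖ
  refine eq_of_forall_ge_iff fun a => ?_
  rw [← pow_mul_mem_iff _ hϖ', ← pow_mul_mem_iff _ hϖ, mem_map, map_mul, map_pow]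
  simp [mapRingEquiv]

/-- A place is rational if its residue class field is `K`. -/
def IsRational (P : FFPlace K F) : Prop :=
  ∀ f ∈ P.ring, ∃ a : K, f - algebraMap K F a ∈ P.ring.nonunits

theorem isRational_of_degree_eq_one {P : FFPlace K F} (hP : P.degree = 1) : P.IsRational := by
  intro f hf
  obtain ⟨a, ha⟩ := (finrank_eq_one_iff_of_nonzero' (1 : P.residueField) one_ne_zero).1 hP
    (IsLocalRing.residue P.ring ⟨f, hf⟩)
  refine ⟨a, ?_⟩
  rw [Algebra.smul_def, mul_one] at ha
  change IsLocalRing.residue P.ring (algebraMap K P.ring a) = _ at ha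
  rw [eq_comm, ← sub_eq_zero, ← map_sub, IsLocalRing.residue_eq_zero_iff] at ha
  exact ValuationSubring.coe_mem_nonunits_iff.2 ha

theorem IsRational.map {P : FFPlace K F} (hP : P.IsRational) (σ : F ≃ₐ[K] F) :
    (P.map σ).IsRational := fun f hf => by
  obtain ⟨a, ha⟩ := hP _ hf
  refine ⟨a, ?_⟩
  rw [mem_nonunits_map, map_sub, AlgEquiv.commutes]
  exact ha

theorem IsRational.sub_value_mem {P : FFPlace K F} (hP : P.IsRational) {f : F} (hf : f ∈ P.ring) :
    f - algebraMap K F (P.value f) ∈ P.ring.nonunits :=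
  Classical.epsilon_spec (p := fun a : K => f - algebraMap K F a ∈ P.ring.nonunits) (hP f hf)

/-! ### Separating rational places over a finite field -/

theorem IsRational.pow_card_sub_mem_nonunits [Finite K] {P : FFPlace K F} (hP : P.IsRational)
    {y : F} (hy : y ∈ P.ring) : y ^ Nat.card K - y ∈ P.ring.nonunits := by
  obtain ⟨a, ha⟩ := hP y hy
  have hK : a ^ Nat.card K = a := by
    have := Fintype.ofFinite K
    rw [Nat.card_eq_fintype_card, FiniteField.pow_card]
  have hres : IsLocalRing.residue P.ring ⟨y, hy⟩ =
      IsLocalRing.residue P.ring (algebraMap K P.ring a) := by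
    rw [← sub_eq_zero, ← map_sub, IsLocalRing.residue_eq_zero_iff]
    exact ValuationSubring.coe_mem_nonunits_iff.1 ha
  have : (⟨y, hy⟩ ^ Nat.card K - ⟨y, hy⟩ : P.ring) ∈ IsLocalRing.maximalIdeal P.ring := by
    rw [← IsLocalRing.residue_eq_zero_iff, map_sub, map_pow, hres, ← map_pow, ← map_pow, hK,
      sub_self]
  exact ValuationSubring.coe_mem_nonunits_iff.2 this

theorem IsRational.inv_sub_one_mem_nonunits [Finite K] {P : FFPlace K F} (hP : P.IsRational)
    {y : F} (hy : y ∈ P.ring) :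
    (1 + (y ^ Nat.card K - y))⁻¹ - 1 ∈ P.ring.nonunits := by
  have h := hP.pow_card_sub_mem_nonunits hy
  rw [ValuationSubring.mem_nonunits_iff] at h ⊢
  have h1 := Valuation.map_one_add_of_lt _ h
  have h0 : 1 + (y ^ Nat.card K - y) ≠ 0 := fun h => by simp [h] at h1
  have : (1 + (y ^ Nat.card K - y))⁻¹ - 1 =
      -((y ^ Nat.card K - y) * (1 + (y ^ Nat.card K - y))⁻¹) := by
    field_simp
    ring
  rw [this, Valuation.map_neg, map_mul, map_inv₀, h1, inv_one, mul_one]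
  exact h

theorem inv_mem_nonunits_of_notMem [Finite K] (P : FFPlace K F) {y : F} (hy : y ∉ P.ring) :
    (1 + (y ^ Nat.card K - y))⁻¹ ∈ P.ring.nonunits := by
  rw [← P.ring.valuation_le_one_iff, not_le] at hy
  have h1 : P.ring.valuation y < P.ring.valuation (y ^ Nat.card K) := by
    rw [map_pow]
    exact lt_self_pow₀ hy Finite.one_lt_card
  have h2 : 1 < P.ring.valuation (y ^ Nat.card K - y) := by
    rw [Valuation.map_sub_eq_of_lt_left _ h1]
    exact hy.trans h1
  have h3 : P.ring.valuation (1 + (y ^ Nat.card K - y)) = _ :=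
    Valuation.map_add_eq_of_lt_right _ (by rwa [Valuation.map_one])
  rw [ValuationSubring.mem_nonunits_iff, map_inv₀, h3]
  exact inv_lt_one_of_one_lt₀ h2

/-- Approximation at finitely many rational places. The function `1 / (y ^ q - y + 1)`, with
`q` the cardinality of `K`, is regular at all rational places, with value `1` where `y` is regular
and value `0` at the poles of `y`. -/
theorem exists_dual_family [Finite K] (hF : IsAlgebraicFunctionField K F) {ι : Type*} [Fintype ι]
    {R : ι → FFPlace K F} (hR : ∀ i, (R i).IsRational) (hinj : Function.Injective R) :
    ∃ t : ι → F, (∀ i j, t i ∈ (R j).ring) ∧ (∀ i, t i - 1 ∈ (R i).ring.nonunits) ∧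
      ∀ i j, i ≠ j → t i ∈ (R j).ring.nonunits := by
  classical
  have hy : ∀ i j, ∃ y : F, i ≠ j → y ∈ (R i).ring ∧ y ∉ (R j).ring := by
    intro i j
    by_cases hij : i = j
    · exact ⟨0, fun h => absurd hij h⟩
    have := (R i).isDiscreteValuationRing hF
    have hle : ¬ (R i).ring ≤ (R j).ring := fun h => hij (hinj ((R i).eq_of_ring_le (R j) h))
    obtain ⟨y, h1, h2⟩ := SetLike.not_le_iff_exists.1 hle
    exact ⟨y, fun _ => ⟨h1, h2⟩⟩
  choose y hy using hy
  set u : ι → ι → F := fun i j => (1 + (y i j ^ Nat.card K - y i j))⁻¹ with hu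
  have hu1 : ∀ i j, i ≠ j → u i j - 1 ∈ (R i).ring.nonunits := fun i j hij =>
    (hR i).inv_sub_one_mem_nonunits (hy i j hij).1
  have hu0 : ∀ i j, i ≠ j → u i j ∈ (R j).ring.nonunits := fun i j hij =>
    (R j).inv_mem_nonunits_of_notMem (hy i j hij).2
  have hreg : ∀ i j k, u i j ∈ (R k).ring := by
    intro i j k
    by_cases h : y i j ∈ (R k).ring
    · have := ValuationSubring.nonunits_subset ((hR k).inv_sub_one_mem_nonunits h)
      simpa using add_mem this (one_mem (R k).ring)
    · exact ValuationSubring.nonunits_subset ((R k).inv_mem_nonunits_of_notMem h)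
  refine ⟨fun i => ∏ j ∈ Finset.univ.erase i, u i j, fun i j => prod_mem fun k _ => hreg i k j,
    fun i => ?_, fun i j hij => ?_⟩
  · refine (Finset.prod_induction (u i) (fun x => x ∈ (R i).ring ∧ x - 1 ∈ (R i).ring.nonunits)
      ?_ ?_ ?_).2
    · rintro a b ⟨ha, ha'⟩ ⟨hb, hb'⟩
      refine ⟨mul_mem ha hb, ?_⟩
      have : a * b - 1 = a * (b - 1) + (a - 1) := by ring
      rw [this]
      exact add_mem ((R i).mul_mem_nonunits ha hb') ha'
    · exact ⟨one_mem _, by simp⟩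
    · intro j hj
      exact ⟨hreg i j i, hu1 i j (Finset.ne_of_mem_erase hj).symm⟩
  · dsimp only
    rw [← Finset.prod_erase_mul _ _ (Finset.mem_erase.2 ⟨hij.symm, Finset.mem_univ j⟩)]
    exact (R j).mul_mem_nonunits (prod_mem fun k _ => hreg i k j) (hu0 i j hij)

/-! ### Zeros and poles -/

/-- A function without poles is a constant. -/
theorem isAlgebraic_of_forall_mem {f : F} (hf : ∀ S : FFPlace K F, f ∈ S.ring) :
    IsAlgebraic K f := by
  have hmem : f ∈ (⨅ V : {V : ValuationSubring F //
      ((algebraMap K F).range : Set F) ⊆ V.toSubring}, V.1.toSubring) := by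
    rw [Subring.mem_iInf]
    rintro ⟨V, hV⟩
    by_cases hV' : V = ⊤
    · subst hV'
      exact ValuationSubring.mem_top f
    · exact hf ⟨V, fun a => hV ⟨a, rfl⟩, hV'⟩
  rw [iInf_valuationSubring_superset, Subring.closure_eq] at hmem
  obtain ⟨q, hq, hqf⟩ : IsIntegral (algebraMap K F).range f := hmem
  refine IsIntegral.isAlgebraic ?_
  obtain ⟨q', hq', -, hm⟩ := Polynomial.lifts_and_degree_eq_and_monic
    (f := (algebraMap K F).rangeRestrict) (p := q)
    ((Polynomial.lifts_iff_coeffs_subset_range _).2 fun c _ => by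
      rw [Set.mem_range]
      exact RingHom.rangeRestrict_surjective _ c) hq
  refine ⟨q', hm, ?_⟩
  rw [← hq', eval₂_map] at hqf
  exact hqf

theorem card_quotient_maximalIdeal_pow [Finite K] (hF : IsAlgebraicFunctionField K F)
    (P : FFPlace K F) (a : ℕ) :
    Nat.card (P.ring ⧸ IsLocalRing.maximalIdeal P.ring ^ a) = Nat.card K ^ (P.degree * a) := by
  have := P.isDiscreteValuationRing hF
  have := P.finite_residueField hF
  have h := cardQuot_pow_of_prime (P := IsLocalRing.maximalIdeal P.ring) P.maximalIdeal_ne_bot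
    (i := a)
  rw [Submodule.cardQuot_apply, Submodule.cardQuot_apply] at h
  rw [h, pow_mul, degree]
  congr 1
  exact Module.natCard_eq_pow_finrank (K := K) (V := P.residueField)

/-- A function has at most as many rational zeros as the degree of its pole divisor.

Let `t i` be functions with `t i (R j) = δ i j`. The functions `w ^ j * t i` are independent over
`K`, and multiplication by a suitable polynomial `φ` in `w` removes their poles outside `Q`. The
span of those with `1 ≤ j ≤ l` embeds into the space of principal parts of order at most
`l * m + c` along `Q`, since a function without poles that vanishes somewhere is `0`. Comparing
cardinalities as `l` grows gives the inequality. -/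
theorem card_rational_zeros_le [Finite K] (hF : IsAlgebraicFunctionField K F)
    {ι κ : Type*} [Fintype ι] [Fintype κ] {R : ι → FFPlace K F} (hR : ∀ i, (R i).IsRational)
    (hinj : Function.Injective R) {w : F} (hw : Transcendental K w)
    (hwR : ∀ i, w ∈ (R i).ring.nonunits) (Q : κ → FFPlace K F)
    (hQ : ∀ S : FFPlace K F, w ∉ S.ring → ∃ k, S = Q k) :
    Fintype.card ι ≤ ∑ k, (Q k).degree * (Q k).poleOrder w := by
  classical
  rcases isEmpty_or_nonempty ι with hι | ⟨⟨i₀⟩⟩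
  · simp
  have hw0 : w ≠ 0 := by
    rintro rfl
    exact hw isAlgebraic_zero
  have hdvr : ∀ k, IsDiscreteValuationRing (Q k).ring := fun k => (Q k).isDiscreteValuationRing hF
  obtain ⟨t, htR, ht1, ht0⟩ := exists_dual_family hF hR hinj
  have halg := Algebra.isAlgebraic_adjoin_of_transcendental hF hw
  obtain ⟨φ, hφ0, hφ⟩ := Algebra.IsAlgebraic.exists_integral_multiples (Algebra.adjoin K {w})
    (Finset.univ.image t)
  replace hφ0 : (φ : F) ≠ 0 := by simpa using hφ0
  -- elements of `K[w]` are regular where `w` is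
  have hadj : ∀ S : FFPlace K F, w ∈ S.ring → ∀ x : Algebra.adjoin K {w}, (x : F) ∈ S.ring :=
    fun S hS x => (Algebra.adjoin_le (S := S.toSubalgebra) (by simpa using hS)) x.2
  have hφt : ∀ S : FFPlace K F, w ∈ S.ring → ∀ i, (φ : F) * t i ∈ S.ring := fun S hS i =>
    S.mem_ring_of_isIntegralElem (algebraMap (Algebra.adjoin K {w}) F) (hadj S hS)
      (hφ (t i) (by simp))
  choose ϖ hϖ using fun k => IsDiscreteValuationRing.exists_irreducible (Q k).ring
  set m : κ → ℕ := fun k => (Q k).poleOrder w with hm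
  -- `c k` bounds the pole orders of the `φ * t i` at `Q k`, independently of `l`
  set c : κ → ℕ := fun k => Finset.univ.sup fun i => (Q k).poleOrder (φ * t i) with hc
  suffices key : ∀ l : ℕ, Fintype.card ι * l ≤ ∑ k, (Q k).degree * (l * m k + c k) by
    by_contra! hlt
    have h1 : ∀ l, Fintype.card ι * l ≤
        l * ∑ k, (Q k).degree * m k + ∑ k, (Q k).degree * c k := fun l => by
      refine (key l).trans (le_of_eq ?_)
      rw [Finset.mul_sum, ← Finset.sum_add_distrib]
      exact Finset.sum_congr rfl fun k _ => by ring
    have h2 := h1 (∑ k, (Q k).degree * c k + 1)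
    have h3 := Nat.mul_le_mul_right (∑ k, (Q k).degree * c k + 1) (Nat.succ_le_of_lt hlt)
    simp only [hm] at h2
    linarith
  intro l
  set g : (ι × Fin l → K) → F := fun b => ∑ x, b x • (φ * (w ^ (x.2 + 1 : ℕ) * t x.1)) with hg
  have hgsub : ∀ b b', g b - g b' = g (b - b') := fun b b' => by
    simp only [hg, ← Finset.sum_sub_distrib, ← sub_smul, Pi.sub_apply]
  have hgQ : ∀ b k, (ϖ k : F) ^ (l * m k + c k) * g b ∈ (Q k).ring := by
    intro b k
    rw [hg, Finset.mul_sum]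
    refine sum_mem fun x _ => ?_
    have h1 : ((ϖ k : F) ^ m k * w) ^ (x.2 + 1 : ℕ) ∈ (Q k).ring :=
      pow_mem (((Q k).pow_mul_mem_iff (hϖ k) w _).2 le_rfl) _
    have h2 : (ϖ k : F) ^ c k * (φ * t x.1) ∈ (Q k).ring :=
      ((Q k).pow_mul_mem_iff (hϖ k) _ _).2
        (Finset.le_sup (f := fun i => (Q k).poleOrder (φ * t i)) (Finset.mem_univ x.1))
    have h3 : (ϖ k : F) ^ (m k * (l - (x.2 + 1))) ∈ (Q k).ring := pow_mem (ϖ k).2 _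
    have h4 := mul_mem ((Q k).algebraMap_mem (b x)) (mul_mem h3 (mul_mem h1 h2))
    convert h4 using 1
    have h5 : l * m k + c k = m k * (l - (x.2 + 1)) + m k * (x.2 + 1) + c k := by
      rw [← mul_add, Nat.sub_add_cancel x.2.2, mul_comm]
    rw [h5, Algebra.smul_def]
    ring
  -- a combination regular along `Q` has no poles and vanishes at `R i₀`, so it is `0`
  have hg0 : ∀ b, (∀ k, g b ∈ (Q k).ring) → b = 0 := by
    intro b hb
    have hreg : ∀ S : FFPlace K F, g b ∈ S.ring := by
      intro S
      by_cases hS : w ∈ S.ring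
      · refine sum_mem fun x _ => ?_
        rw [Algebra.smul_def, mul_left_comm (φ : F)]
        exact mul_mem (S.algebraMap_mem _) (mul_mem (pow_mem hS _) (hφt S hS _))
      · obtain ⟨k, rfl⟩ := hQ S hS
        exact hb k
    have hvan : g b ∈ (R i₀).ring.nonunits := by
      refine sum_mem fun x _ => ?_
      have hwi := ValuationSubring.nonunits_subset (hwR i₀)
      have : b x • ((φ : F) * (w ^ (x.2 + 1 : ℕ) * t x.1)) =
          algebraMap K F (b x) * (φ * t x.1) * w ^ (x.2 : ℕ) * w := by
        rw [Algebra.smul_def]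
        ring
      rw [this]
      exact (R i₀).mul_mem_nonunits (mul_mem (mul_mem ((R i₀).algebraMap_mem _)
        (hφt _ hwi _)) (pow_mem hwi _)) (hwR i₀)
    have hzero := (R i₀).eq_zero_of_isAlgebraic (isAlgebraic_of_forall_mem hreg) hvan
    set q : ι → K[X] := fun i => ∑ j : Fin l, C (b (i, j)) * X ^ (j + 1 : ℕ) with hq
    have hqsum : ∑ i, aeval w (q i) * t i = 0 := by
      refine (mul_eq_zero.1 ((?_ : (φ : F) * _ = g b).trans hzero)).resolve_left hφ0
      simp only [hg]
      rw [Fintype.sum_prod_type, Finset.mul_sum]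
      refine Finset.sum_congr rfl fun i _ => ?_
      rw [hq, map_sum, Finset.sum_mul, Finset.mul_sum]
      refine Finset.sum_congr rfl fun j _ => ?_
      rw [map_mul, aeval_C, map_pow, aeval_X, Algebra.smul_def]
      ring
    have hq0 := eq_zero_of_sum_aeval_mul_eq_zero (⨅ i, (R i).toSubalgebra) (w := w)
      (by simpa [Algebra.mem_iInf] using fun i => ValuationSubring.nonunits_subset (hwR i)) hw0
      (t := t) (fun i => by simpa [Algebra.mem_iInf] using htR i) (fun a f hf haf => ?_) q hqsum
    · funext x
      have h1 : (q x.1).coeff (x.2 + 1) = 0 := by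
        rw [hq0]
        simp
      rw [hq] at h1
      simpa [coeff_X_pow, Fin.val_inj] using h1
    · -- evaluation of the relation at `R j`
      funext j
      have hf' : f ∈ (R j).ring := by
        have := (Algebra.mem_iInf.1 hf) j
        exact this
      have h1 : w * f ∈ (R j).ring.nonunits := by
        rw [mul_comm]
        exact (R j).mul_mem_nonunits hf' (hwR j)
      have h2 : algebraMap K F (a j) = w * f - (∑ i ∈ Finset.univ.erase j, a i • t i) -
          algebraMap K F (a j) * (t j - 1) := by
        rw [← haf, ← Finset.add_sum_erase _ _ (Finset.mem_univ j), Algebra.smul_def]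
        ring
      have h3 : algebraMap K F (a j) ∈ (R j).ring.nonunits := by
        rw [h2]
        refine sub_mem (sub_mem h1 (sum_mem fun i hi => ?_))
          ((R j).mul_mem_nonunits ((R j).algebraMap_mem _) (ht1 j))
        rw [Algebra.smul_def]
        exact (R j).mul_mem_nonunits ((R j).algebraMap_mem _) (ht0 i j (Finset.ne_of_mem_erase hi))
      have h4 := (R j).eq_zero_of_isAlgebraic (isAlgebraic_algebraMap (a j)) h3
      simpa using h4
  -- the principal parts of `g b`
  set Φ : (ι × Fin l → K) → ∀ k, (Q k).ring ⧸
      IsLocalRing.maximalIdeal (Q k).ring ^ (l * m k + c k) :=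
    fun b k => Ideal.Quotient.mk _ ⟨_, hgQ b k⟩ with hΦ
  have hΦinj : Function.Injective Φ := by
    intro b b' hbb'
    refine sub_eq_zero.1 (hg0 _ fun k => ?_)
    have h1 := congrFun hbb' k
    rw [hΦ] at h1
    simp only at h1
    rw [Ideal.Quotient.eq, (hϖ k).maximalIdeal_eq, Ideal.span_singleton_pow,
      Ideal.mem_span_singleton] at h1
    obtain ⟨f, hf⟩ := h1
    have h2 : (ϖ k : F) ^ (l * m k + c k) * (g b - g b') =
        (ϖ k : F) ^ (l * m k + c k) * f := by
      rw [mul_sub]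
      exact congrArg Subtype.val hf
    have h3 : (ϖ k : F) ≠ 0 := fun h => (hϖ k).ne_zero (Subtype.ext h)
    rw [← hgsub, mul_left_cancel₀ (pow_ne_zero _ h3) h2]
    exact f.2
  have hcard : Nat.card (∀ k, (Q k).ring ⧸
      IsLocalRing.maximalIdeal (Q k).ring ^ (l * m k + c k)) =
      Nat.card K ^ ∑ k, (Q k).degree * (l * m k + c k) := by
    rw [Nat.card_pi, ← Finset.prod_pow_eq_pow_sum]
    exact Finset.prod_congr rfl fun k _ => card_quotient_maximalIdeal_pow hF _ _
  have hfin := Nat.finite_of_card_ne_zero (hcard.trans_ne (pow_ne_zero _ Nat.card_pos.ne'))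
  have h := Nat.card_le_card_of_injective Φ hΦinj
  rw [hcard, Nat.card_fun, Nat.card_eq_fintype_card (α := ι × Fin l), Fintype.card_prod,
    Fintype.card_fin] at h
  exact (Nat.pow_le_pow_iff_right Finite.one_lt_card).1 h

end FFPlace

end

/-! ### Sequences over the prime field -/

theorem Algebra.algebraMap_trace_of_natCard_eq {p : ℕ} [Fact p.Prime] {K : Type*} [Field K]
    [Algebra (ZMod p) K] (hq : Nat.card K = p) (a : K) :
    algebraMap (ZMod p) K (Algebra.trace (ZMod p) K a) = a := by
  have hfin : Finite K := Nat.finite_of_card_ne_zero (hq.trans_ne (NeZero.ne p))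
  have hbij : Function.Bijective (algebraMap (ZMod p) K) :=
    (algebraMap (ZMod p) K).injective.bijective_of_nat_card_le (by rw [hq, Nat.card_zmod])
  have hrank : Module.finrank (ZMod p) K = 1 :=
    (LinearEquiv.ofBijective (Algebra.linearMap (ZMod p) K) hbij).finrank_eq.symm.trans
      (Module.finrank_self _)
  obtain ⟨b, rfl⟩ := hbij.2 a
  rw [Algebra.trace_algebraMap, hrank, one_smul]

theorem exists_recurrence_of_finiteLinearComplexity {k : Type*} [Field k] (N : ℕ) (s : ℕ → k) :
    ∃ c : ℕ → k, c 0 = 1 ∧ ∀ i : ℕ, i + finiteLinearComplexity N s < N →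
      ∑ j ∈ Finset.range (finiteLinearComplexity N s + 1),
        c j * s (i + (finiteLinearComplexity N s - j)) = 0 := by
  have hne : {L : ℕ | ∃ c : ℕ → k, c 0 = 1 ∧ c L ≠ 0 ∧ ∀ i : ℕ, i + L < N →
      ∑ j ∈ Finset.range (L + 1), c j * s (i + (L - j)) = 0}.Nonempty :=
    -- a recurrence of length `N` imposes no condition
    ⟨N, fun _ => 1, rfl, one_ne_zero, fun i hi => by omega⟩
  obtain ⟨c, h0, -, h⟩ := Nat.sInf_mem hne
  exact ⟨c, h0, h⟩

theorem finiteLinearComplexity_le_linearComplexity {k : Type*} [Field k] {n : ℕ} (hn : 0 < n)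
    {s : ℕ → k} (hs : ∀ i, s (i + n) = s i) (N : ℕ) :
    finiteLinearComplexity N s ≤ linearComplexity s := by
  -- the recurrence `s (i + n) = s i`
  have hne : {L : ℕ | ∃ c : ℕ → k, c 0 = 1 ∧ c L ≠ 0 ∧ ∀ i : ℕ,
      ∑ j ∈ Finset.range (L + 1), c j * s (i + (L - j)) = 0}.Nonempty := by
    refine ⟨n, fun j => (if j = 0 then 1 else 0) - (if j = n then 1 else 0), ?_, ?_, fun i => ?_⟩
    · simp [hn.ne]
    · simp [hn.ne']
    · simp [sub_mul, hs]
  obtain ⟨c, h0, hL, h⟩ := Nat.sInf_mem hne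
  exact Nat.sInf_le ⟨c, h0, hL, fun i _ => h i⟩

/-! ### The function attached to a recurrence -/

namespace FFPlace

variable {K F : Type*} [Field K] [Field F] [Algebra K F]

theorem map_pow_add_of_map_pow_eq {σ : F ≃ₐ[K] F} {P : FFPlace K F} {n : ℕ}
    (h : P.map (σ ^ n) = P) (i : ℕ) : P.map (σ ^ (i + n)) = P.map (σ ^ i) := by
  rw [pow_add, ← map_map, h]

/-- The orbit of `P` has no repetition before the first return to `P`. -/
theorem map_pow_injOn {σ : F ≃ₐ[K] F} {P : FFPlace K F} {n : ℕ}
    (hn : IsLeast {k : ℕ | 0 < k ∧ P.map (σ ^ k) = P} n) :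
    ∀ i < n, ∀ j < n, P.map (σ ^ i) = P.map (σ ^ j) → i = j := by
  have key : ∀ i j : ℕ, i < j → j < n → P.map (σ ^ i) ≠ P.map (σ ^ j) := by
    intro i j hij hj h
    rw [show j = i + (j - i) by omega, pow_add, ← map_map] at h
    have := hn.2 ⟨show 0 < j - i by omega, (map_injective (σ ^ i) h.symm)⟩
    omega
  intro i hi j hj h
  rcases lt_trichotomy i j with hij | hij | hij
  · exact absurd h (key i j hij hj)
  · exact hij
  · exact absurd h.symm (key j i hij hi)

/-- The zeros of `w = ∑ j, c j • σ ^ -(L - j) z` include `P i` for `i + L < n`, where the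
recurrence holds, and its poles are among `σ ^ -k Q` for `k ≤ L`, of at most the order of the pole
of `z` at `Q`. The leading coefficient `c 0 = 1` keeps the pole at `σ ^ -L Q`, so `w` is not
constant. -/
theorem sub_le_of_recurrence [Finite K] (hF : IsAlgebraicFunctionField K F) (σ : F ≃ₐ[K] F)
    {P : FFPlace K F} (hP : P.IsRational) {n : ℕ}
    (hPinj : ∀ i < n, ∀ j < n, P.map (σ ^ i) = P.map (σ ^ j) → i = j)
    {z : F} (hz : ∀ i : ℕ, z ∈ (P.map (σ ^ i)).ring) {Q : FFPlace K F} (hQ : z ∉ Q.ring)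
    (hQunique : ∀ R : FFPlace K F, z ∉ R.ring → R = Q)
    (hdist : ∀ i < n, ∀ j < n, Q.map (σ ^ i) = Q.map (σ ^ j) → i = j)
    {L : ℕ} (hL : L < n) {c : ℕ → K} (hc0 : c 0 = 1)
    (hc : ∀ i : ℕ, i + L < n →
      ∑ j ∈ Finset.range (L + 1), c j * (P.map (σ ^ (i + (L - j)))).value z = 0) :
    n - L ≤ (L + 1) * (Q.degree * Q.poleOrder z) := by
  set w : F := ∑ j ∈ Finset.range (L + 1), c j • (σ ^ (L - j))⁻¹ z with hw
  -- poles of `w`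
  have hQmap : ∀ (k : ℕ) (S : FFPlace K F), (σ ^ k)⁻¹ z ∉ S.ring → S = Q.map (σ ^ k)⁻¹ := by
    intro k S hS
    have h1 : S.map (σ ^ k) = Q := hQunique _ hS
    rw [← h1, map_map, inv_mul_cancel, map_one]
  have hpole : ∀ S : FFPlace K F, w ∉ S.ring → ∃ k : Fin (L + 1), S = Q.map (σ ^ (k : ℕ))⁻¹ := by
    intro S hS
    by_contra! hne
    refine hS (sum_mem fun j hj => ?_)
    rw [Algebra.smul_def]
    refine mul_mem (S.algebraMap_mem _) ?_
    by_contra h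
    exact hne ⟨L - j, by omega⟩ (hQmap _ _ h)
  have hQne : ∀ k < L, Q.map (σ ^ k)⁻¹ ≠ Q.map (σ ^ L)⁻¹ := by
    intro k hk h
    have h1 := congrArg (map (σ ^ (k + L))) h
    rw [map_map, map_map, pow_add, mul_inv_cancel_right, ← pow_add, add_comm, pow_add,
      mul_inv_cancel_right] at h1
    have := hdist L hL k (hk.trans hL) h1
    omega
  have htr : Transcendental K w := by
    intro halg
    have hmem := (Q.map (σ ^ L)⁻¹).mem_ring_of_isAlgebraic halg
    rw [hw, Finset.sum_range_succ', hc0, one_smul, Nat.sub_zero] at hmem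
    have h1 : ∑ j ∈ Finset.range L, c (j + 1) • (σ ^ (L - (j + 1)))⁻¹ z ∈
        (Q.map (σ ^ L)⁻¹).ring := by
      refine sum_mem fun j hj => ?_
      rw [Algebra.smul_def]
      refine mul_mem ((Q.map (σ ^ L)⁻¹).algebraMap_mem _) ?_
      have := Finset.mem_range.1 hj
      by_contra h
      exact hQne (L - (j + 1)) (by omega) (hQmap _ _ h).symm
    have h2 : (σ ^ L)⁻¹ z ∈ (Q.map (σ ^ L)⁻¹).ring := by
      simpa using sub_mem hmem h1
    rw [mem_map] at h2
    exact hQ (by simpa [AlgEquiv.aut_inv] using h2)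
  -- zeros of `w`
  have hzero : ∀ i : Fin (n - L), w ∈ (P.map (σ ^ (i : ℕ))).ring.nonunits := by
    intro i
    have h1 : w = ∑ j ∈ Finset.range (L + 1), c j • ((σ ^ (L - j))⁻¹ z -
        algebraMap K F ((P.map (σ ^ (i + (L - j)))).value z)) := by
      have h2 := congrArg (algebraMap K F) (hc i (by omega))
      rw [map_sum, _root_.map_zero] at h2
      simp only [Algebra.smul_def, mul_sub, Finset.sum_sub_distrib, ← _root_.map_mul, h2, sub_zero,
        hw]
    rw [h1]
    refine sum_mem fun j hj => ?_
    rw [Algebra.smul_def]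
    refine mul_mem_nonunits _ (algebraMap_mem _ _) ?_
    have h3 := (hP.map (σ ^ (i + (L - j)))).sub_value_mem (hz _)
    set a := (P.map (σ ^ (i + (L - j)))).value z
    rw [add_comm, pow_add, ← map_map, mem_nonunits_map, map_sub, AlgEquiv.commutes] at h3
    exact h3
  have hcount := card_rational_zeros_le hF (R := fun i : Fin (n - L) => P.map (σ ^ (i : ℕ)))
    (fun i => hP.map _) (fun i j h => Fin.ext (hPinj i (by omega) j (by omega) h)) htr hzero
    (fun k : Fin (L + 1) => Q.map (σ ^ (k : ℕ))⁻¹) hpole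
  have hord : ∀ S : FFPlace K F, S.degree = Q.degree →
      (∀ j, S.poleOrder ((σ ^ j)⁻¹ z) ≤ Q.poleOrder z) →
      S.degree * S.poleOrder w ≤ Q.degree * Q.poleOrder z := by
    intro S hS hj
    have := S.isDiscreteValuationRing hF
    obtain ⟨ϖ, hϖ⟩ := IsDiscreteValuationRing.exists_irreducible S.ring
    rw [hS]
    refine Nat.mul_le_mul_left _ ((S.pow_mul_mem_iff hϖ _ _).1 ?_)
    rw [hw, Finset.mul_sum]
    refine sum_mem fun j _ => ?_
    rw [mul_smul_comm, Algebra.smul_def]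
    exact mul_mem (S.algebraMap_mem _) ((S.pow_mul_mem_iff hϖ _ _).2 (hj _))
  have hordS : ∀ (S : FFPlace K F) (j : ℕ), S.poleOrder ((σ ^ j)⁻¹ z) ≤ Q.poleOrder z := by
    intro S j
    have := S.isDiscreteValuationRing hF
    by_cases h : (σ ^ j)⁻¹ z ∈ S.ring
    · rw [(S.poleOrder_eq_zero_iff _).2 h]
      exact Nat.zero_le _
    · rw [hQmap j S h, poleOrder_map hF]
      simp [AlgEquiv.aut_inv]
  rw [Fintype.card_fin] at hcount
  refine hcount.trans ((Finset.sum_le_card_nsmul _ _ _ fun k _ =>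
    hord _ (degree_map _ _) (hordS _)).trans (le_of_eq ?_))
  simp

theorem poleDivisorDegree_eq_of_unique_pole (hF : IsAlgebraicFunctionField K F) {z : F}
    {Q : FFPlace K F} (hQunique : ∀ R : FFPlace K F, R.IsPole z → R = Q) :
    poleDivisorDegree K z = Q.poleOrder z * Q.degree := by
  refine finsum_eq_single _ Q fun R hR => ?_
  have := R.isDiscreteValuationRing hF
  have h : z ∈ R.ring := by
    by_contra h
    exact hR (hQunique R ((R.isPole_iff_notMem z).2 h))
  rw [(R.poleOrder_eq_zero_iff z).2 h, zero_mul]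

end FFPlace

theorem mainTheorem6 (p : ℕ) [Fact p.Prime]
    {K F : Type*} [Field K] [Algebra (ZMod p) K] (hq : Nat.card K = p)
    [Field F] [Algebra K F] (hF : IsAlgebraicFunctionField K F)
    (σ : F ≃ₐ[K] F) (P : FFPlace K F) (hP : P.degree = 1)
    (n : ℕ) (hn : IsLeast {k : ℕ | 0 < k ∧ P.map (σ ^ k) = P} n)
    (z : F) (hz : ∀ i : ℕ, 0 ≤ (P.map (σ ^ i)).v z)
    (Q : FFPlace K F) (hQ : Q.IsPole z) (hQunique : ∀ R : FFPlace K F, R.IsPole z → R = Q)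
    (hQp : Int.gcd (Q.v z) p = 1)
    (hdist : ∀ i < n, ∀ j < n, Q.map (σ ^ i) = Q.map (σ ^ j) → i = j)
    (d : ℕ) (hd : d = Q.degree ∨ d = FFPlace.poleDivisorDegree K z) :
    ((n : ℝ) - Q.reducedPoleOrder p z * d) / (Q.reducedPoleOrder p z * d + 1) ≤
        finiteLinearComplexity n (traceSequence p σ P z) ∧
      ((n : ℝ) - Q.reducedPoleOrder p z * d) / (Q.reducedPoleOrder p z * d + 1) ≤
        linearComplexity (traceSequence p σ P z) := by
  have hp : p.Prime := Fact.out
  have : Finite K := Nat.finite_of_card_ne_zero (hq.trans_ne hp.ne_zero)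
  have hdvr : ∀ S : FFPlace K F, IsDiscreteValuationRing S.ring :=
    fun S => S.isDiscreteValuationRing hF
  have hper : ∀ i, traceSequence p σ P z (i + n) = traceSequence p σ P z i := fun i => by
    rw [traceSequence, traceSequence, FFPlace.map_pow_add_of_map_pow_eq hn.1.2]
  rw [Q.reducedPoleOrder_eq_poleOrder hp.one_lt hQ hQp]
  have hm : 1 ≤ Q.poleOrder z := by
    rw [FFPlace.IsPole] at hQ
    rw [FFPlace.poleOrder]
    omega
  have hdQ : Q.degree ≤ d := by
    rcases hd with rfl | rfl
    · exact le_rfl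
    · rw [FFPlace.poleDivisorDegree_eq_of_unique_pole hF hQunique]
      exact Nat.le_mul_of_pos_left _ hm
  have hle := finiteLinearComplexity_le_linearComplexity hn.1.1 hper n
  obtain ⟨c, hc0, hc⟩ := exists_recurrence_of_finiteLinearComplexity n (traceSequence p σ P z)
  set L := finiteLinearComplexity n (traceSequence p σ P z)
  have hbound : n ≤ (L + 1) * (Q.poleOrder z * d) + L := by
    rcases le_or_gt n L with hnL | hLn
    · omega
    have h := FFPlace.sub_le_of_recurrence hF σ (FFPlace.isRational_of_degree_eq_one hP)
      (FFPlace.map_pow_injOn hn) (fun i => (FFPlace.v_nonneg_iff_mem _ z).1 (hz i))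
      ((Q.isPole_iff_notMem z).1 hQ) (fun R hR => hQunique R ((R.isPole_iff_notMem z).2 hR)) hdist
      hLn (c := fun j => algebraMap (ZMod p) K (c j)) (by simp [hc0]) (fun i hi => by
        have h := congrArg (algebraMap (ZMod p) K) (hc i hi)
        simpa only [map_sum, map_mul, map_zero, traceSequence,
          Algebra.algebraMap_trace_of_natCard_eq hq] using h)
    have h2 : (L + 1) * (Q.degree * Q.poleOrder z) ≤ (L + 1) * (Q.poleOrder z * d) := by
      rw [mul_comm Q.degree]
      gcongr
    omega
  have hreal : ((n : ℝ) - Q.poleOrder z * d) / (Q.poleOrder z * d + 1) ≤ L := by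
    rw [div_le_iff₀ (by positivity)]
    have : (n : ℝ) ≤ (L + 1) * (Q.poleOrder z * d) + L := by exact_mod_cast hbound
    linarith
  exact ⟨hreal, hreal.trans (by exact_mod_cast hle)⟩
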